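/- Let $(M,d)$ be a separable metric space in which every closed bounded set is compact, endowed with its Borel $\sigma$-algebra, and let $(I,\mathscr I,\nu)$ be a probability space. A continuous map $f\colon M\to M$ is called a \emph{paracontraction} if $d(f(y),x)<d(y,x)$ for every fixed point $x$ of $f$ and every $y\in M$ that is not a fixed point of $f$. Let $f_i\colon M\to M$, $i\in I$, be paracontractions such that $i\mapsto f_i(x)$ is measurable for every $x\in M$ (since the $f_i$ are continuous, this is the same as joint measurability of $(i,x)\mapsto f_i(x)$), and put $$C=\{x\in M\colon f_i(x)=x\ \text{for } \nu\text{-almost every } i\in I\}.$$ Let $(\xi_n)_{n\ge 0}$ be an ergodic stationary sequence of $I$-valued random variables on a probability space $(\Omega,\mathscr F,\mathbb P)$, each with distribution $\nu$; that is, the law of $(\xi_0,\xi_1,\dots)$ on $I^{\mathbb N}$ with the product $\sigma$-algebra is invariant and ergodic for the shift $(\omega_n)_n\mapsto(\omega_{n+1})_n$. Theorem. Assume that $C$ is non-empty. Then, for every $x_0\in M$, the sequence $(X_n)$ defined by $X_0=x_0$ and $X_{n+1}=f_{\xi_n}(X_n)$ for $n\ge 0$ converges $\mathbb P$-almost surely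 to a random variable $X\colon\Omega\to M$ taking values in $C$. -/

import Mathlib

open Set Filter Topology MeasureTheory ProbabilityTheory

/-- A continuous self-map `f` of a metric space is a paracontraction if it strictly decreases the
distance from every non-fixed point `y` to every fixed point `x`. -/
structure IsParacontraction {M : Type*} [MetricSpace M] (f : M → M) : Prop where
  continuous : Continuous f
  dist_lt : ∀ x y : M, f x = x → f y ≠ y → dist (f y) x < dist y x

/-- The solution set of the stochastic feasibility problem: the points that are fixed by
`f i` for `ν`-almost every `i`. -/
def commonFixedPoints {I M : Type*} [MeasurableSpace I] (ν : Measure I) (f : I → M → M) : Set M :=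
  {x | ∀ᵐ i ∂ν, f i x = x}

/-- The left shift on the space of sequences in `I`. -/
def seqShift {I : Type*} (s : ℕ → I) : ℕ → I := fun n => s (n + 1)

/-- `ξ` is an ergodic stationary sequence of `I`-valued random variables on `(Ω, P)`: each `ξ n` is
measurable, and the law of `(ξ 0, ξ 1, …)` on the product space `ℕ → I` (with the product
σ-algebra) is invariant (stationarity) and ergodic for the left shift. Mathlib's `Ergodic`
comprises both the invariance and the zero-one law for invariant measurable sets. -/
structure IsErgodicStationary {Ω I : Type*} [MeasurableSpace Ω] [MeasurableSpace I]
    (ξ : ℕ → Ω → I) (P : Measure Ω) : Prop where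
  measurable : ∀ n, Measurable (ξ n)
  ergodic : Ergodic seqShift (P.map (fun ω n => ξ n ω))

/-- The random iteration `X₀ = x₀`, `X_{n+1} = f_{ξ_n}(X_n)`. -/
def randomIteration {Ω I M : Type*} (f : I → M → M) (ξ : ℕ → Ω → I) (x₀ : M) : ℕ → Ω → M
  | 0 => fun _ => x₀
  | n + 1 => fun ω => f (ξ n ω) (randomIteration f ξ x₀ n ω)

/-! Fix `z` in the solution set. Almost surely every map fixes `z`, so the distance from the orbit
to `z` decreases to a limit, and late stretches of the orbit hardly approach `z`. If the orbit stays
in a compact `V`, late shifts of the driving sequence therefore lie in `nearlyFixing f z V m`. By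
stationarity, staying in `V` is at most as likely as this event, for every `m`; by compactness these
events shrink, almost surely, to `fixingSeqs f V`. That set is null when `V` misses the solution
set, by ergodicity (`measure_fixingSeqs_eq_zero`). So the orbit comes arbitrarily close to the
solution set, and monotonicity of distances makes it converge. -/

/-- The iteration `x, f (s 0) x, f (s 1) (f (s 0) x), …` driven by the sequence `s`. -/
def orbit {I M : Type*} (f : I → M → M) (s : ℕ → I) : ℕ → M → M
  | 0 => id
  | n + 1 => fun x => f (s n) (orbit f s n x)

theorem iterate_seqShift_apply {I : Type*} (s : ℕ → I) (n k : ℕ) :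
    seqShift^[n] s k = s (n + k) := by
  induction n generalizing s with
  | zero => simp
  | succ n ih => rw [Function.iterate_succ_apply, ih, seqShift, add_right_comm]

theorem orbit_add {I M : Type*} (f : I → M → M) (s : ℕ → I) (n m : ℕ) (x : M) :
    orbit f s (n + m) x = orbit f (seqShift^[n] s) m (orbit f s n x) := by
  induction m with
  | zero => rfl
  | succ m ih =>
    change f (s (n + m)) (orbit f s (n + m) x) = f _ (orbit f (seqShift^[n] s) m (orbit f s n x))
    rw [ih, iterate_seqShift_apply]

theorem randomIteration_eq_orbit {Ω I M : Type*} (f : I → M → M) (ξ : ℕ → Ω → I) (x : M) (n : ℕ)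
    (ω : Ω) : randomIteration f ξ x n ω = orbit f (fun k => ξ k ω) n x := by
  induction n with
  | zero => rfl
  | succ n ih => exact congrArg (f (ξ n ω)) ih

theorem IsParacontraction.dist_le {M : Type*} [MetricSpace M] {g : M → M}
    (hg : IsParacontraction g) {x : M} (hx : g x = x) (y : M) : dist (g y) x ≤ dist y x := by
  by_cases hy : g y = y
  · rw [hy]
  · exact (hg.dist_lt x y hx hy).le

/-! ### Orbits along a fixed driving sequence -/

section

variable {I M : Type*} [MetricSpace M] {f : I → M → M}

theorem continuous_orbit (hf : ∀ i, IsParacontraction (f i)) (s : ℕ → I) (n : ℕ) :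
    Continuous (orbit f s n) := by
  induction n with
  | zero => exact continuous_id
  | succ n ih => exact (hf (s n)).continuous.comp ih

theorem antitone_dist_orbit (hf : ∀ i, IsParacontraction (f i)) {s : ℕ → I} {z : M}
    (hz : ∀ k, f (s k) z = z) (x : M) : Antitone fun n => dist (orbit f s n x) z :=
  antitone_nat_of_succ_le fun n => (hf (s n)).dist_le (hz n) _

/-- The first map to move `x` would bring it strictly closer to `z`, and no later map could undo
this. -/
theorem fixed_of_dist_le_orbit (hf : ∀ i, IsParacontraction (f i)) {s : ℕ → I} {z x : M}
    (hz : ∀ k, f (s k) z = z) (hx : ∀ n, dist x z ≤ dist (orbit f s n x) z) (k : ℕ) :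
    f (s k) x = x := by
  have key : ∀ n, orbit f s n x = x → f (s n) x = x := fun n hn => by
    by_contra hne
    have h := (hf (s n)).dist_lt z x (hz n) hne
    have h' : dist x z ≤ dist (f (s n) (orbit f s n x)) z := hx (n + 1)
    rw [hn] at h'
    exact absurd h h'.not_gt
  have horb : ∀ n, orbit f s n x = x := fun n => by
    induction n with
    | zero => rfl
    | succ n ih =>
      change f (s n) (orbit f s n x) = x
      rw [ih, key n ih]
  exact key k (horb k)

/-- The sequences for which some point of `V` moves towards `z` by less than `1 / (m + 1)` during
the first `m` steps. -/
def nearlyFixing (f : I → M → M) (z : M) (V : Set M) (m : ℕ) : Set (ℕ → I) :=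
  {s | ∃ x ∈ V, ∀ j ≤ m, dist x z < dist (orbit f s j x) z + 1 / ((m : ℝ) + 1)}

/-- The sequences all of whose maps fix a common point of `V`. -/
def fixingSeqs (f : I → M → M) (V : Set M) : Set (ℕ → I) :=
  {s | ∃ x ∈ V, ∀ k, f (s k) x = x}

theorem antitone_nearlyFixing (z : M) (V : Set M) : Antitone (nearlyFixing f z V) := by
  rintro m n hmn s ⟨x, hx, h⟩
  refine ⟨x, hx, fun j hj => (h j (hj.trans hmn)).trans_le ?_⟩
  gcongr

theorem mem_iInter_nearlyFixing_iff (hf : ∀ i, IsParacontraction (f i)) {s : ℕ → I} {z : M}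
    (hz : ∀ k, f (s k) z = z) {V : Set M} (hV : IsCompact V) :
    s ∈ ⋂ m, nearlyFixing f z V m ↔ s ∈ fixingSeqs f V := by
  rw [mem_iInter]
  constructor
  · intro h
    -- Weak inequalities make these nested sets compact, so they share a point.
    let T : ℕ → Set M := fun m =>
      V ∩ ⋂ j ∈ Iic m, {x | dist x z ≤ dist (orbit f s j x) z + 1 / ((m : ℝ) + 1)}
    have hcl : ∀ m, IsClosed (T m) := fun m => hV.isClosed.inter <| isClosed_biInter fun j _ =>
      isClosed_le (by fun_prop)
        (((continuous_orbit hf s j).dist continuous_const).add continuous_const)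
    obtain ⟨x, hx⟩ := IsCompact.nonempty_iInter_of_sequence_nonempty_isCompact_isClosed T
      (fun m x hx => by
        simp only [T, mem_inter_iff, mem_iInter, mem_Iic, mem_ofPred_eq] at hx ⊢
        refine ⟨hx.1, fun j hj => (hx.2 j (hj.trans m.le_succ)).trans ?_⟩
        gcongr
        simp)
      (fun m => by
        obtain ⟨x, hx, hx'⟩ := h m
        exact ⟨x, hx, mem_iInter₂.2 fun j hj => (hx' j hj).le⟩)
      (hV.of_isClosed_subset (hcl 0) inter_subset_left) hcl
    simp only [T, mem_inter_iff, mem_iInter, mem_Iic, mem_ofPred_eq] at hx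
    refine ⟨x, (hx 0).1, fixed_of_dist_le_orbit hf hz fun n => ?_⟩
    have hlim : Tendsto (fun m : ℕ => dist (orbit f s n x) z + 1 / ((m : ℝ) + 1)) atTop
        (𝓝 (dist (orbit f s n x) z + 0)) :=
      tendsto_const_nhds.add tendsto_one_div_add_atTop_nhds_zero_nat
    rw [add_zero] at hlim
    exact ge_of_tendsto hlim ((eventually_ge_atTop n).mono fun m hm => (hx m).2 n hm)
  · rintro ⟨x, hx, hfix⟩ m
    have horb : ∀ n, orbit f s n x = x := fun n => by
      induction n with
      | zero => rfl
      | succ n ih =>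
        change f (s n) (orbit f s n x) = x
        rw [ih, hfix]
    refine ⟨x, hx, fun j _ => ?_⟩
    rw [horb]
    exact lt_add_of_pos_right _ (by positivity)

/-- Once the orbit is within `ε` of a point of `C`, it remains so, hence it is Cauchy. -/
theorem exists_tendsto_orbit [ProperSpace M] (hf : ∀ i, IsParacontraction (f i)) {s : ℕ → I}
    {C : Set M} (hC : IsClosed C) (hne : C.Nonempty) (hs : ∀ k, ∀ x ∈ C, f (s k) x = x) {x₀ : M}
    (h : ∀ ε > 0, ∃ n, Metric.infDist (orbit f s n x₀) C < ε) :
    ∃ x ∈ C, Tendsto (fun n => orbit f s n x₀) atTop (𝓝 x) := by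
  have near : ∀ ε > 0, ∃ N, ∃ c ∈ C, ∀ n ≥ N, dist (orbit f s n x₀) c < ε := fun ε hε => by
    obtain ⟨N, hN⟩ := h ε hε
    obtain ⟨c, hc, hNc⟩ := (Metric.infDist_lt_iff hne).1 hN
    exact ⟨N, c, hc, fun n hn =>
      (antitone_dist_orbit hf (fun k => hs k c hc) x₀ hn).trans_lt hNc⟩
  have hcauchy : CauchySeq fun n => orbit f s n x₀ := by
    refine Metric.cauchySeq_iff.2 fun ε hε => ?_
    obtain ⟨N, c, -, hN⟩ := near (ε / 2) (half_pos hε)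
    refine ⟨N, fun m hm n hn => (dist_triangle_right _ _ c).trans_lt ?_⟩
    linarith [hN m hm, hN n hn]
  obtain ⟨x, hx⟩ := cauchySeq_tendsto_of_complete hcauchy
  refine ⟨x, ?_, hx⟩
  rw [hC.mem_iff_infDist_zero hne]
  refine le_antisymm (le_of_forall_pos_le_add fun ε hε => ?_) Metric.infDist_nonneg
  obtain ⟨N, c, hc, hN⟩ := near ε hε
  rw [zero_add]
  exact (Metric.infDist_le_dist_of_mem hc).trans <| le_of_tendsto (hx.dist tendsto_const_nhds)
    ((eventually_ge_atTop N).mono fun n hn => (hN n hn).le)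

end

/-! ### Measurability and the ergodic argument -/

section

variable {I M : Type*} [MeasurableSpace I] [MetricSpace M] {f : I → M → M}

/-- A countable dense subset yields one null set for all points; continuity does the rest. -/
theorem ae_forall_mem_commonFixedPoints [TopologicalSpace.SeparableSpace M] (ν : Measure I)
    (hf : ∀ i, IsParacontraction (f i)) :
    ∀ᵐ i ∂ν, ∀ x ∈ commonFixedPoints ν f, f i x = x := by
  obtain ⟨t, htC, htc, hCt⟩ := (TopologicalSpace.IsSeparable.of_separableSpace
    (commonFixedPoints ν f)).exists_countable_dense_subset
  filter_upwards [(ae_ball_iff htc).2 fun x hx => htC hx] with i hi x hx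
  exact closure_minimal (t := {y | f i y = y}) hi
    (isClosed_eq (hf i).continuous continuous_id) (hCt hx)

theorem isClosed_commonFixedPoints [TopologicalSpace.SeparableSpace M] (ν : Measure I)
    (hf : ∀ i, IsParacontraction (f i)) : IsClosed (commonFixedPoints ν f) := by
  refine isClosed_of_closure_subset fun x hx => ?_
  filter_upwards [ae_forall_mem_commonFixedPoints ν hf] with i hi
  exact closure_minimal (t := {y | f i y = y}) hi
    (isClosed_eq (hf i).continuous continuous_id) hx

variable [TopologicalSpace.SeparableSpace M] [MeasurableSpace M] [BorelSpace M]

theorem measurable_orbit (hf : ∀ i, IsParacontraction (f i))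
    (hf_meas : ∀ x, Measurable fun i => f i x) (n : ℕ) (x : M) :
    Measurable fun s => orbit f s n x := by
  have : SecondCountableTopology M := UniformSpace.secondCountable_of_separable M
  induction n with
  | zero => exact measurable_const
  | succ n ih =>
    have hu : Measurable (Function.uncurry fun x i => f i x) :=
      measurable_uncurry_of_continuous_of_measurable (fun i => (hf i).continuous) hf_meas
    exact hu.comp (ih.prodMk (measurable_pi_apply n))

theorem measurableSet_nearlyFixing (hf : ∀ i, IsParacontraction (f i))
    (hf_meas : ∀ x, Measurable fun i => f i x) (z : M) (V : Set M) (m : ℕ) :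
    MeasurableSet (nearlyFixing f z V m) := by
  obtain ⟨t, htV, htc, hVt⟩ :=
    (TopologicalSpace.IsSeparable.of_separableSpace V).exists_countable_dense_subset
  -- The strict inequalities are open in `x`, so witnesses from a countable dense subset suffice.
  have heq : nearlyFixing f z V m = ⋃ x ∈ t, ⋂ j ∈ Iic m,
      {s | dist x z < dist (orbit f s j x) z + 1 / ((m : ℝ) + 1)} := by
    ext s
    simp only [mem_iUnion, mem_iInter, mem_Iic, mem_ofPred_eq, exists_prop]
    constructor
    · rintro ⟨x, hx, h⟩
      have hopen : IsOpen (⋂ j ∈ Iic m,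
          {x | dist x z < dist (orbit f s j x) z + 1 / ((m : ℝ) + 1)}) :=
        (finite_Iic m).isOpen_biInter fun j _ => isOpen_lt (by fun_prop)
          (((continuous_orbit hf s j).dist continuous_const).add continuous_const)
      obtain ⟨y, hy, hyt⟩ := mem_closure_iff.1 (hVt hx) _ hopen (mem_iInter₂.2 h)
      exact ⟨y, hyt, mem_iInter₂.1 hy⟩
    · rintro ⟨x, hx, h⟩
      exact ⟨x, htV hx, h⟩
  rw [heq]
  exact .biUnion htc fun x _ => .biInter (to_countable _) fun j _ =>
    measurableSet_lt measurable_const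
      (((measurable_orbit hf hf_meas j x).dist measurable_const).add_const _)

variable {ν : Measure I} {Q : Measure (ℕ → I)}

/-- For a driving law that is ergodic for the shift, almost no sequence of maps has a common fixed
point in a compact set that misses `commonFixedPoints ν f`. -/
theorem measure_fixingSeqs_eq_zero [IsProbabilityMeasure Q] [ProperSpace M]
    (hf : ∀ i, IsParacontraction (f i)) (hf_meas : ∀ x, Measurable fun i => f i x)
    (hQ : Ergodic seqShift Q) (hQν : ∀ n, Q.map (fun s => s n) = ν) {z : M}
    (hz : ∀ᵐ s ∂Q, ∀ k, f (s k) z = z) {V : Set M} (hV : IsCompact V)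
    (hVC : Disjoint V (commonFixedPoints ν f)) : Q (fixingSeqs f V) = 0 := by
  have zero_one : ∀ W : Set M, IsCompact W →
      Q (fixingSeqs f W) = 0 ∨ ∀ᵐ s ∂Q, s ∈ fixingSeqs f W := fun W hW => by
    have hae : (⋂ m, nearlyFixing f z W m : Set (ℕ → I)) =ᵐ[Q] fixingSeqs f W := by
      filter_upwards [hz] with s hs
      exact propext (mem_iInter_nearlyFixing_iff hf hs hW)
    have hnull : NullMeasurableSet (fixingSeqs f W) Q :=
      (MeasurableSet.iInter fun m =>
        measurableSet_nearlyFixing hf hf_meas z W m).nullMeasurableSet.congr hae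
    -- Dropping the first map preserves a common fixed point; this one-sided invariance is enough
    -- for ergodicity.
    refine (hQ.ae_empty_or_univ_of_ae_le_preimage hnull <| Eventually.of_forall ?_).imp
      ae_eq_empty.1 eventuallyEq_univ.1
    rintro s ⟨x, hx, h⟩
    exact ⟨x, hx, fun k => h (k + 1)⟩
  refine hV.induction_on (p := fun W => Q (fixingSeqs f W) = 0) ?_ ?_ ?_ ?_
  · simp [fixingSeqs]
  · intro s t hst ht
    refine measure_mono_null ?_ ht
    rintro u ⟨x, hx, h⟩
    exact ⟨x, hst hx, h⟩
  · intro s t hs ht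
    refine measure_mono_null ?_ (measure_union_null hs ht)
    rintro u ⟨x, hx | hx, h⟩
    exacts [Or.inl ⟨x, hx, h⟩, Or.inr ⟨x, hx, h⟩]
  -- If no neighbourhood of `x` in `V` gives a null set, the zero-one law makes every ball around
  -- `x` contain a common fixed point almost surely. Shrinking the balls puts `x` in the solution
  -- set.
  · intro x hx
    by_contra! hcon
    refine hVC.notMem_of_mem_left hx ?_
    have hballs : ∀ᵐ s ∂Q, ∀ n : ℕ,
        s ∈ fixingSeqs f (Metric.closedBall x (1 / ((n : ℝ) + 1))) := ae_all_iff.2 fun n =>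
      (zero_one _ (isCompact_closedBall _ _)).resolve_left <| hcon _ <|
        mem_nhdsWithin_of_mem_nhds <| Metric.closedBall_mem_nhds _ (by positivity)
    have hfix : ∀ᵐ s ∂Q, f (s 0) x = x := by
      filter_upwards [hballs] with s hs
      choose y hy hy' using hs
      have hlim : Tendsto y atTop (𝓝 x) := tendsto_iff_dist_tendsto_zero.2 <|
        squeeze_zero (fun _ => dist_nonneg) hy tendsto_one_div_add_atTop_nhds_zero_nat
      refine tendsto_nhds_unique (((hf (s 0)).continuous.tendsto x).comp hlim) ?_
      exact hlim.congr fun n => (hy' n 0).symm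
    have hmeas : MeasurableSet {i | f i x = x} := hf_meas x (measurableSet_singleton x)
    change ∀ᵐ i ∂ν, f i x = x
    rw [← hQν 0]
    exact (ae_map_iff (measurable_pi_apply 0).aemeasurable hmeas).2 hfix

theorem measure_orbit_stays_eq_zero [IsProbabilityMeasure Q] [ProperSpace M]
    (hf : ∀ i, IsParacontraction (f i)) (hf_meas : ∀ x, Measurable fun i => f i x)
    (hQ : Ergodic seqShift Q) (hQν : ∀ n, Q.map (fun s => s n) = ν) {z : M}
    (hz : ∀ᵐ s ∂Q, ∀ k, f (s k) z = z) {V : Set M} (hV : IsCompact V)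
    (hVC : Disjoint V (commonFixedPoints ν f)) (x₀ : M) :
    Q {s | ∀ n, orbit f s n x₀ ∈ V} = 0 := by
  have hle : ∀ m, Q {s | ∀ n, orbit f s n x₀ ∈ V} ≤ Q (nearlyFixing f z V m) := fun m => by
    let L : ℕ → Set (ℕ → I) := fun N => ⋂ n ≥ N, seqShift^[n] ⁻¹' nearlyFixing f z V m
    have hmono : Monotone L := fun a b hab =>
      biInter_subset_biInter_left fun n (hn : b ≤ n) => hab.trans hn
    have hsub : {s | ∀ n, orbit f s n x₀ ∈ V} ≤ᵐ[Q] ⋃ N, L N := by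
      filter_upwards [hz] with s hs hsV
      have hanti := antitone_dist_orbit hf hs x₀
      have hbdd : BddBelow (range fun n => dist (orbit f s n x₀) z) :=
        ⟨0, forall_mem_range.2 fun n => dist_nonneg⟩
      have hlim := tendsto_atTop_ciInf hanti hbdd
      obtain ⟨N, hN⟩ := eventually_atTop.1 <| hlim.eventually_lt_const
        (lt_add_of_pos_right _ (show (0 : ℝ) < 1 / ((m : ℝ) + 1) by positivity))
      -- The witness for the sequence shifted by `n` is the orbit point at time `n`.
      refine mem_iUnion.2 ⟨N, mem_iInter₂.2 fun n hn => ⟨_, hsV n, fun j _ => ?_⟩⟩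
      rw [← orbit_add]
      have := ciInf_le hbdd (n + j)
      exact (hN n hn).trans_le (by gcongr)
    calc Q {s | ∀ n, orbit f s n x₀ ∈ V} ≤ Q (⋃ N, L N) := measure_mono_ae hsub
      _ = ⨆ N, Q (L N) := hmono.measure_iUnion
      _ ≤ Q (nearlyFixing f z V m) := iSup_le fun N => by
        refine (measure_mono (biInter_subset_of_mem (le_refl N))).trans_eq ?_
        exact (hQ.toMeasurePreserving.iterate N).measure_preimage
          (measurableSet_nearlyFixing hf hf_meas z V m).nullMeasurableSet
  have hlim := tendsto_measure_iInter_atTop (μ := Q) (s := nearlyFixing f z V)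
    (fun m => (measurableSet_nearlyFixing hf hf_meas z V m).nullMeasurableSet)
    (antitone_nearlyFixing z V) ⟨0, measure_ne_top _ _⟩
  have hzero : Q (⋂ m, nearlyFixing f z V m) = 0 := by
    rw [← measure_fixingSeqs_eq_zero hf hf_meas hQ hQν hz hV hVC]
    refine measure_congr ?_
    filter_upwards [hz] with s hs
    exact propext (mem_iInter_nearlyFixing_iff hf hs hV)
  rw [hzero] at hlim
  exact le_antisymm (ge_of_tendsto' hlim hle) zero_le

theorem ae_exists_tendsto_orbit [IsProbabilityMeasure Q] [ProperSpace M]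
    (hf : ∀ i, IsParacontraction (f i)) (hf_meas : ∀ x, Measurable fun i => f i x)
    (hQ : Ergodic seqShift Q) (hQν : ∀ n, Q.map (fun s => s n) = ν)
    (hC : (commonFixedPoints ν f).Nonempty) (x₀ : M) :
    ∀ᵐ s ∂Q, ∃ x ∈ commonFixedPoints ν f,
      Tendsto (fun n => orbit f s n x₀) atTop (𝓝 x) := by
  have hclosed := isClosed_commonFixedPoints ν hf
  have hfix : ∀ᵐ s ∂Q, ∀ k, ∀ x ∈ commonFixedPoints ν f, f (s k) x = x :=
    ae_all_iff.2 fun k => ae_of_ae_map (measurable_pi_apply k).aemeasurable <| by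
      rw [hQν k]
      exact ae_forall_mem_commonFixedPoints ν hf
  obtain ⟨z, hzC⟩ := hC
  have hz : ∀ᵐ s ∂Q, ∀ k, f (s k) z = z := hfix.mono fun s hs k => hs k z hzC
  have hnear : ∀ᵐ s ∂Q, ∀ m : ℕ, ∃ n,
      Metric.infDist (orbit f s n x₀) (commonFixedPoints ν f) < 1 / ((m : ℝ) + 1) := by
    refine ae_all_iff.2 fun m => ?_
    -- The orbit never leaves this ball, so leaving `V` means coming close to the solution set.
    let V : Set M := Metric.closedBall z (dist x₀ z) ∩
      {x | 1 / ((m : ℝ) + 1) ≤ Metric.infDist x (commonFixedPoints ν f)}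
    have hV : IsCompact V := (isCompact_closedBall _ _).inter_right
      (isClosed_le continuous_const (Metric.continuous_infDist_pt _))
    have hVC : Disjoint V (commonFixedPoints ν f) := by
      refine disjoint_left.2 fun x hx hxC => ?_
      have h : 1 / ((m : ℝ) + 1) ≤ Metric.infDist x (commonFixedPoints ν f) := hx.2
      rw [Metric.infDist_zero_of_mem hxC] at h
      exact absurd h (not_le.2 (by positivity))
    have hstay : ∀ᵐ s ∂Q, ¬ ∀ n, orbit f s n x₀ ∈ V :=
      measure_eq_zero_iff_ae_notMem.1
        (measure_orbit_stays_eq_zero hf hf_meas hQ hQν hz hV hVC x₀)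
    filter_upwards [hstay, hz] with s hs hsz
    by_contra! hcon
    exact hs fun n => ⟨antitone_dist_orbit hf hsz x₀ (Nat.zero_le n), hcon n⟩
  filter_upwards [hfix, hnear] with s hs hsn
  refine exists_tendsto_orbit hf hclosed ⟨z, hzC⟩ hs fun ε hε => ?_
  obtain ⟨m, hm⟩ := exists_nat_one_div_lt hε
  obtain ⟨n, hn⟩ := hsn m
  exact ⟨n, hn.trans hm⟩

end

theorem mainTheorem2 {Ω I M : Type*}
    [MeasurableSpace Ω] (P : Measure Ω) [IsProbabilityMeasure P]
    [MeasurableSpace I] (ν : Measure I) [IsProbabilityMeasure ν]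
    [MetricSpace M] [TopologicalSpace.SeparableSpace M]
    (hM : ∀ K : Set M, IsClosed K → Bornology.IsBounded K → IsCompact K)
    [MeasurableSpace M] [BorelSpace M]
    (f : I → M → M) (hf : ∀ i, IsParacontraction (f i))
    (hf_meas : ∀ x, Measurable (fun i => f i x))
    (ξ : ℕ → Ω → I) (hξ : IsErgodicStationary ξ P) (hξν : ∀ n, P.map (ξ n) = ν)
    (hC : (commonFixedPoints ν f).Nonempty) (x₀ : M) :
    ∃ X : Ω → M, Measurable X ∧ (∀ ω, X ω ∈ commonFixedPoints ν f) ∧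
      ∀ᵐ ω ∂P, Tendsto (fun n => randomIteration f ξ x₀ n ω) atTop (𝓝 (X ω)) := by
  classical
  have : ProperSpace M :=
    ⟨fun _ _ => hM _ Metric.isClosed_closedBall Metric.isBounded_closedBall⟩
  have hΞ : Measurable fun ω n => ξ n ω := measurable_pi_lambda _ hξ.measurable
  have : IsProbabilityMeasure (P.map fun ω n => ξ n ω) :=
    Measure.isProbabilityMeasure_map hΞ.aemeasurable
  have hmarg : ∀ n, (P.map fun ω n => ξ n ω).map (fun s => s n) = ν := fun n => by
    rw [Measure.map_map (measurable_pi_apply n) hΞ, ← hξν n]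
    rfl
  have hconv : ∀ᵐ ω ∂P, ∃ x ∈ commonFixedPoints ν f,
      Tendsto (fun n => randomIteration f ξ x₀ n ω) atTop (𝓝 x) := by
    simp only [randomIteration_eq_orbit]
    exact ae_of_ae_map hΞ.aemeasurable
      (ae_exists_tendsto_orbit hf hf_meas hξ.ergodic hmarg hC x₀)
  have hmeas : ∀ n, Measurable (randomIteration f ξ x₀ n) := fun n => by
    rw [show randomIteration f ξ x₀ n = fun ω => orbit f (fun k => ξ k ω) n x₀ from
      funext (randomIteration_eq_orbit f ξ x₀ n)]
    exact (measurable_orbit hf hf_meas n x₀).comp hΞ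
  obtain ⟨Y, hY, hYlim⟩ := measurable_limit_of_tendsto_metrizable_ae (L := atTop)
    (fun n => (hmeas n).aemeasurable) (hconv.mono fun ω ⟨x, _, hx⟩ => ⟨x, hx⟩)
  obtain ⟨z, hz⟩ := hC
  -- The limit `Y` is corrected on a null set so that its values always lie in the solution set.
  refine ⟨fun ω => if Y ω ∈ commonFixedPoints ν f then Y ω else z,
    hY.ite (hY (isClosed_commonFixedPoints ν hf).measurableSet) measurable_const,
    fun ω => ?_, ?_⟩
  · dsimp only
    split_ifs with h
    exacts [h, hz]
  · filter_upwards [hconv, hYlim] with ω ⟨x, hxC, hx⟩ hYω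
    obtain rfl := tendsto_nhds_unique hx hYω
    rwa [if_pos hxC]
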